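/- Let $\ell\ge 1$ be an integer and let $K:\mathbb{R}\to\mathbb{R}$ be a kernel of order $\ell$, i.e. $u^jK(u)\in L_1(\mathbb{R})$ for $j=0,\dots,\ell$, $\int K(u)\,du=1$, $\int u^jK(u)\,du=0$ for $1\le j\le \ell-1$, and $\int u^\ell K(u)\,du\neq 0$ ($K$ may take negative values). Let $X_1,X_2,\dots$ be iid real random variables with continuous distribution function $F$. Let $F_n(x)=\frac1n\sum_{i=1}^n \mathbb{I}(X_i\le x)$ be the empirical distribution function of $X_1,\dots,X_n$ and, for $h>0$, let $$\hat F_n^h(x)=\int_{-\infty}^x \frac{1}{nh}\sum_{i=1}^n K\!\left(\frac{t-X_i}{h}\right)dt .$$ Let $d$ be either the Kolmogorov distance $d(G,H)=\sup_{x\in\mathbb{R}}|G(x)-H(x)|$ or, for some integer $k\ge1$, the $k$-th order Kuiper distance $$d(G,H)=\sup_{a_1\le b_1\le a_2\le b_2\le\dots\le a_k\le b_k}\ \sum_{i=1}^k\bigl|(G(b_i)-G(a_i))-(H(b_i)-H(a_i))\bigr| .$$ Let $s(n)$ be a deterministic real sequence with $s(n)\to0$ as $n\to\infty$. Then, almost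 surely, for every sequence $(h_{s,n})_n$ (which may depend on the sample) such that, for all sufficiently large $n$, $h_{s,n}>0$ and $$d(F_n,\hat F_n^{h_{s,n}})=s(n),$$ we have 1. $d(F,\hat F_n^{h_{s,n}})\longrightarrow 0$, and 2. $h_{s,n}\longrightarrow 0$ as $n\to\infty$. -/

import Mathlib

open MeasureTheory ProbabilityTheory Filter Topology Set

/-- `K` is a kernel of order `ℓ ≥ 1`: the functions `u ↦ u ^ j * K u`, `0 ≤ j ≤ ℓ`, are Lebesgue
integrable, `K` has total integral one, its moments of orders `1, …, ℓ - 1` vanish and its moment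
of order `ℓ` does not. No sign condition is imposed on `K`. -/
structure IsKernelOfOrder (K : ℝ → ℝ) (ℓ : ℕ) : Prop where
  one_le_order : 1 ≤ ℓ
  integrable_moment : ∀ j : ℕ, j ≤ ℓ → Integrable (fun u : ℝ => u ^ j * K u) volume
  integral_eq_one : ∫ u : ℝ, K u = 1
  moment_eq_zero : ∀ j : ℕ, 1 ≤ j → j < ℓ → ∫ u : ℝ, u ^ j * K u = 0
  moment_ne_zero : ∫ u : ℝ, u ^ ℓ * K u ≠ 0

/-- The rescaled kernel `K_h(u) = h⁻¹ K(h⁻¹ u)`. -/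
noncomputable def scaledKernel (K : ℝ → ℝ) (h u : ℝ) : ℝ :=
  h⁻¹ * K (h⁻¹ * u)

/-- The empirical distribution function `F_n` of the first `n` observations
`x 0, …, x (n - 1)` of a sequence `x`. -/
noncomputable def empiricalCDF (x : ℕ → ℝ) (n : ℕ) (t : ℝ) : ℝ :=
  (n : ℝ)⁻¹ * ∑ i ∈ Finset.range n, (Set.Ici (x i)).indicator (fun _ => (1 : ℝ)) t

/-- The kernel density estimator with bandwidth `h` based on the first `n` observations. -/
noncomputable def kernelDensityEstimator (K : ℝ → ℝ) (h : ℝ) (x : ℕ → ℝ) (n : ℕ) (t : ℝ) : ℝ :=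
  (n : ℝ)⁻¹ * ∑ i ∈ Finset.range n, scaledKernel K h (t - x i)

/-- The kernel estimator of the distribution function, `t ↦ ∫_{-∞}^t f̂_h`. -/
noncomputable def kernelCDFEstimator (K : ℝ → ℝ) (h : ℝ) (x : ℕ → ℝ) (n : ℕ) (t : ℝ) : ℝ :=
  ∫ v in Set.Iic t, kernelDensityEstimator K h x n v

/-- The Kolmogorov distance `‖F - G‖_∞` of two bounded functions. -/
noncomputable def kolmogorovDist (F G : ℝ → ℝ) : ℝ :=
  ⨆ t : ℝ, |F t - G t|

/-- The `k`-th order Kuiper distance of two bounded functions: the supremum over all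
`a₁ ≤ b₁ ≤ a₂ ≤ b₂ ≤ ⋯ ≤ a_k ≤ b_k` of `∑ i, |(F (b i) - F (a i)) - (G (b i) - G (a i))|`. -/
noncomputable def kuiperDist (k : ℕ) (F G : ℝ → ℝ) : ℝ :=
  sSup {r : ℝ | ∃ a b : Fin k → ℝ, (∀ i, a i ≤ b i) ∧ (∀ i j, i < j → b i ≤ a j) ∧
    r = ∑ i, |(F (b i) - F (a i)) - (G (b i) - G (a i))|}

/-! Write `F_n`, `F` for the empirical and true distribution functions. By Glivenko–Cantelli `F_n →
F` uniformly almost surely, and `d` changes by at most a constant times the uniform error, so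
`d(F_n, F̂_n) = s(n) → 0` gives the first claim.

For the second, `F̂_n` is `F_n` smoothed by `K` at bandwidth `h n`. As `K` is integrable, `F_n` may
be replaced by `F`, so the smoothings of `F` converge pointwise to `F`. Let `h n` cluster at some
`L` in `[0, ∞]`. If `L = ∞`, the smoothings tend to a constant, which `F` is not. If `0 < L < ∞`,
smoothing at `L` fixes `F`; dividing by the characteristic function, nonzero near `0`, shows that
the Fourier transform of `K` is `1` near `0`. Its `ℓ`-th derivative at `0` then vanishes, against
the nonzero `ℓ`-th moment (`IsKernelOfOrder.exists_smoothed_cdf_ne`). Hence `L = 0`. -/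

/-! ### Uniform convergence of the empirical distribution function. -/

/-- Pólya's theorem: distribution functions converging at the rationals to a continuous
distribution function converge uniformly. -/
theorem tendstoUniformly_of_tendsto_rat {G : ℕ → ℝ → ℝ} {F : ℝ → ℝ} (hGm : ∀ n, Monotone (G n))
    (hG0 : ∀ n t, 0 ≤ G n t) (hG1 : ∀ n t, G n t ≤ 1) (hFm : Monotone F) (hFc : Continuous F)
    (hF0 : Tendsto F atBot (𝓝 0)) (hF1 : Tendsto F atTop (𝓝 1))
    (hGF : ∀ q : ℚ, Tendsto (fun n => G n q) atTop (𝓝 (F q))) :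
    TendstoUniformly G F atTop := by
  have hFnn : ∀ t, 0 ≤ F t := fun t => hFm.le_of_tendsto hF0 t
  have hFle : ∀ t, F t ≤ 1 := fun t => hFm.ge_of_tendsto hF1 t
  rw [Metric.tendstoUniformly_iff]
  intro ε hε
  by_contra hcon
  have hfreq : ∃ᶠ n in atTop, ∃ t, ε ≤ |F t - G n t| := by
    refine (not_eventually.1 hcon).mono fun n hn => ?_
    push Not at hn
    exact hn
  obtain ⟨x, hx⟩ : ∃ x : ℕ → ℝ, ∃ᶠ n in atTop, ε ≤ |F (x n) - G n (x n)| := by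
    have : ∀ n, ∃ t, (∃ t, ε ≤ |F t - G n t|) → ε ≤ |F t - G n t| := fun n =>
      (em (∃ t, ε ≤ |F t - G n t|)).elim (fun ⟨t, ht⟩ => ⟨t, fun _ => ht⟩)
        fun h => ⟨0, fun h' => absurd h' h⟩
    choose x hx using this
    exact ⟨x, hfreq.mono hx⟩
  -- An ultrafilter on the bad indices makes the points `x n` converge in the compact space `EReal`,
  -- with no extraction of subsequences.
  have : (atTop ⊓ 𝓟 {n | ε ≤ |F (x n) - G n (x n)|}).NeBot := frequently_mem_iff_neBot.1 hx
  let U := Ultrafilter.of (atTop ⊓ 𝓟 {n | ε ≤ |F (x n) - G n (x n)|})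
  have hU : (U : Filter ℕ) ≤ atTop ⊓ 𝓟 {n | ε ≤ |F (x n) - G n (x n)|} := Ultrafilter.of_le _
  have hUt : (U : Filter ℕ) ≤ atTop := hU.trans inf_le_left
  have hUx : ∀ᶠ n in (U : Filter ℕ), ε ≤ |F (x n) - G n (x n)| :=
    (hU.trans inf_le_right) (mem_principal_self _)
  suffices h : ∀ᶠ n in (U : Filter ℕ), |F (x n) - G n (x n)| < ε by
    obtain ⟨n, h1, h2⟩ := (h.and hUx).exists
    exact absurd h1 (not_lt.2 h2)
  have hev : ∀ (q : ℚ) (δ : ℝ), 0 < δ → ∀ᶠ n in (U : Filter ℕ), |G n q - F q| < δ := by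
    intro q δ hδ
    have := (Metric.tendsto_nhds.1 ((hGF q).mono_left hUt)) δ hδ
    exact this
  obtain ⟨l, hl⟩ : ∃ l : EReal, Tendsto (fun n => (x n : EReal)) U (𝓝 l) :=
    ⟨_, (U.map (fun n => (x n : EReal))).le_nhds_lim⟩
  induction l with
  | bot =>
    rw [EReal.tendsto_nhds_bot_iff_real] at hl
    obtain ⟨a, ha⟩ := (hF0.eventually (gt_mem_nhds (half_pos hε))).exists
    obtain ⟨q, hq⟩ := exists_rat_lt a
    have hFq : F q < ε / 2 := (hFm hq.le).trans_lt ha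
    filter_upwards [hl q, hev q (ε / 2) (half_pos hε)] with n h1 h2
    have h1' : x n ≤ q := (EReal.coe_lt_coe_iff.1 h1).le
    have := hFm h1'
    have := hGm n h1'
    rw [abs_lt] at h2 ⊢
    constructor <;> linarith [hFnn (x n), hG0 n (x n)]
  | top =>
    rw [EReal.tendsto_nhds_top_iff_real] at hl
    obtain ⟨a, ha⟩ := (hF1.eventually (lt_mem_nhds (sub_lt_self 1 (half_pos hε)))).exists
    obtain ⟨q, hq⟩ := exists_rat_gt a
    have hFq : 1 - ε / 2 < F q := ha.trans_le (hFm hq.le)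
    filter_upwards [hl q, hev q (ε / 2) (half_pos hε)] with n h1 h2
    have h1' : q ≤ x n := (EReal.coe_lt_coe_iff.1 h1).le
    have := hFm h1'
    have := hGm n h1'
    rw [abs_lt] at h2 ⊢
    constructor <;> linarith [hFle (x n), hG1 n (x n)]
  | coe l =>
    have hl' : Tendsto x U (𝓝 l) := EReal.tendsto_coe.1 hl
    obtain ⟨δ, hδ, hFδ⟩ := Metric.continuousAt_iff.1 hFc.continuousAt (ε / 4) (by positivity)
    obtain ⟨p, hp1, hp2⟩ := exists_rat_btwn (sub_lt_self l hδ)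
    obtain ⟨q, hq1, hq2⟩ := exists_rat_btwn (lt_add_of_pos_right l hδ)
    have hFp : |F p - F l| < ε / 4 := hFδ (by rw [Real.dist_eq, abs_lt]; constructor <;> linarith)
    have hFq : |F q - F l| < ε / 4 := hFδ (by rw [Real.dist_eq, abs_lt]; constructor <;> linarith)
    filter_upwards [hl'.eventually (lt_mem_nhds hp2), hl'.eventually (gt_mem_nhds hq1),
      hev p (ε / 4) (by positivity), hev q (ε / 4) (by positivity)] with n h1 h2 h3 h4
    have := hFm h1.le
    have := hFm h2.le
    have := hGm n h1.le
    have := hGm n h2.le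
    rw [abs_lt] at *
    constructor <;> linarith

theorem empiricalCDF_nonneg (x : ℕ → ℝ) (n : ℕ) (t : ℝ) : 0 ≤ empiricalCDF x n t := by
  unfold empiricalCDF
  exact mul_nonneg (by positivity)
    (Finset.sum_nonneg fun i _ => Set.indicator_nonneg (fun _ _ => zero_le_one) _)

theorem empiricalCDF_le_one (x : ℕ → ℝ) (n : ℕ) (t : ℝ) : empiricalCDF x n t ≤ 1 := by
  unfold empiricalCDF
  have : ∑ i ∈ Finset.range n, (Set.Ici (x i)).indicator (fun _ => (1 : ℝ)) t ≤ n := by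
    refine (Finset.sum_le_card_nsmul _ _ 1 fun i _ => ?_).trans (by simp)
    exact Set.indicator_apply_le' (fun _ => le_rfl) fun _ => zero_le_one
  exact (mul_le_mul_of_nonneg_left this (by positivity)).trans (inv_mul_le_one)

theorem monotone_empiricalCDF (x : ℕ → ℝ) (n : ℕ) : Monotone (empiricalCDF x n) := by
  intro a b hab
  unfold empiricalCDF
  refine mul_le_mul_of_nonneg_left (Finset.sum_le_sum fun i _ => ?_) (by positivity)
  by_cases ha : x i ≤ a
  · simp [Set.indicator, ha, ha.trans hab]
  · simp only [Set.indicator, Set.mem_Ici, ha, if_false]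
    split_ifs <;> simp

/-- The Glivenko–Cantelli theorem for a continuous distribution function. -/
theorem ae_tendstoUniformly_empiricalCDF {Ω : Type*} [MeasurableSpace Ω] {P : Measure Ω}
    [IsProbabilityMeasure P] {μ : Measure ℝ} [IsProbabilityMeasure μ]
    (hμ : Continuous (fun t : ℝ => cdf μ t)) {X : ℕ → Ω → ℝ} (hX_law : ∀ i, HasLaw (X i) μ P)
    (hX_indep : iIndepFun X P) :
    ∀ᵐ ω ∂P, TendstoUniformly (empiricalCDF (fun i => X i ω)) (fun t => cdf μ t) atTop := by
  have h : ∀ᵐ ω ∂P, ∀ q : ℚ,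
      Tendsto (fun n => empiricalCDF (fun i => X i ω) n q) atTop (𝓝 (cdf μ q)) := by
    rw [ae_all_iff]
    intro q
    let g : ℝ → ℝ := (Set.Iic (q : ℝ)).indicator fun _ => 1
    have hg : Measurable g := measurable_const.indicator measurableSet_Iic
    have hgi : Integrable g μ := (integrable_const 1).indicator measurableSet_Iic
    have hident : ∀ i, IdentDistrib (X i) (X 0) P P := fun i =>
      ⟨(hX_law i).aemeasurable, (hX_law 0).aemeasurable, by
        rw [(hX_law i).map_eq, (hX_law 0).map_eq]⟩
    have hint : Integrable (g ∘ X 0) P := by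
      rw [← (hX_law 0).map_eq] at hgi
      exact hgi.comp_aemeasurable (hX_law 0).aemeasurable
    have hE : ∫ ω, (g ∘ X 0) ω ∂P = cdf μ q := by
      have := integral_map (hX_law 0).aemeasurable (f := g) hg.aestronglyMeasurable
      simp only [Function.comp]
      rw [← this, (hX_law 0).map_eq, integral_indicator measurableSet_Iic, cdf_eq_real]
      simp
    have := strong_law_ae_real (fun i => g ∘ X i) hint
      (fun i j hij => (hX_indep.indepFun hij).comp hg hg) (fun i => (hident i).comp hg)
    filter_upwards [this] with ω hω
    rw [hE] at hω
    refine hω.congr fun n => ?_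
    rw [empiricalCDF, div_eq_inv_mul]
    rfl
  filter_upwards [h] with ω hω
  exact tendstoUniformly_of_tendsto_rat (monotone_empiricalCDF _) (empiricalCDF_nonneg _)
    (empiricalCDF_le_one _) (monotone_cdf μ) hμ (tendsto_cdf_atBot μ) (tendsto_cdf_atTop μ) hω

/-! ### Comparison of `d` with pointwise and uniform differences. -/

theorem kolmogorovDist_nonneg (F G : ℝ → ℝ) : 0 ≤ kolmogorovDist F G :=
  Real.iSup_nonneg fun _ => abs_nonneg _

theorem kuiperDist_nonneg (k : ℕ) (F G : ℝ → ℝ) : 0 ≤ kuiperDist k F G := by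
  refine Real.sSup_nonneg ?_
  rintro r ⟨a, b, -, -, rfl⟩
  positivity

/-- The bound `B` is needed because a real supremum over an unbounded family is `0` by default. -/
theorem abs_sub_le_kolmogorovDist {F G : ℝ → ℝ} {B : ℝ} (hB : ∀ t, |F t - G t| ≤ B) (t : ℝ) :
    |F t - G t| ≤ kolmogorovDist F G :=
  le_ciSup (f := fun t => |F t - G t|) ⟨B, by rintro _ ⟨t, rfl⟩; exact hB t⟩ t

theorem sum_increments_le_kuiperDist {F G : ℝ → ℝ} {B : ℝ} (hB : ∀ t, |F t - G t| ≤ B) {k : ℕ}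
    {a b : Fin k → ℝ} (hab : ∀ i, a i ≤ b i) (hba : ∀ i j, i < j → b i ≤ a j) :
    ∑ i, |(F (b i) - F (a i)) - (G (b i) - G (a i))| ≤ kuiperDist k F G := by
  refine le_csSup ⟨k * (B + B), ?_⟩ ⟨a, b, hab, hba, rfl⟩
  rintro r ⟨a, b, -, -, rfl⟩
  refine (Finset.sum_le_card_nsmul _ _ (B + B) fun i _ => ?_).trans (by simp [mul_add])
  calc |(F (b i) - F (a i)) - (G (b i) - G (a i))|
      = |(F (b i) - G (b i)) - (F (a i) - G (a i))| := by ring_nf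
    _ ≤ _ := (abs_sub _ _).trans (add_le_add (hB _) (hB _))

theorem kolmogorovDist_le_add {F G H : ℝ → ℝ} {B c : ℝ} (hB : ∀ t, |G t - H t| ≤ B)
    (hc : ∀ t, |F t - G t| ≤ c) : kolmogorovDist F H ≤ kolmogorovDist G H + c :=
  ciSup_le fun t => by
    linarith [abs_sub_le (F t) (G t) (H t), abs_sub_le_kolmogorovDist hB t, hc t]

theorem kuiperDist_le_add {k : ℕ} {F G H : ℝ → ℝ} {B c : ℝ} (hB : ∀ t, |G t - H t| ≤ B)
    (hc : ∀ t, |F t - G t| ≤ c) : kuiperDist k F H ≤ kuiperDist k G H + k * (c + c) := by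
  refine csSup_le ⟨_, fun _ => 0, fun _ => 0, by simp, by simp, rfl⟩ ?_
  rintro r ⟨a, b, hab, hba, rfl⟩
  refine le_trans ?_ (add_le_add_left (sum_increments_le_kuiperDist hB hab hba) _)
  have : (k : ℝ) * (c + c) = ∑ _i : Fin k, (c + c) := by simp [mul_add]
  rw [this, ← Finset.sum_add_distrib]
  refine Finset.sum_le_sum fun i _ => ?_
  have h1 := abs_le.1 (hc (a i))
  have h2 := abs_le.1 (hc (b i))
  have h3 := neg_abs_le ((G (b i) - G (a i)) - (H (b i) - H (a i)))
  have h4 := le_abs_self ((G (b i) - G (a i)) - (H (b i) - H (a i)))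
  rw [abs_le]
  constructor <;> linarith

theorem abs_sub_le_kuiperDist {k : ℕ} (hk : 1 ≤ k) {F G : ℝ → ℝ} {B : ℝ}
    (hB : ∀ t, |F t - G t| ≤ B) (hF : Tendsto F atBot (𝓝 0)) (hG : Tendsto G atBot (𝓝 0))
    (t : ℝ) : |F t - G t| ≤ kuiperDist k F G := by
  have hlim : Tendsto (fun a => |(F t - F a) - (G t - G a)|) atBot (𝓝 |F t - G t|) := by
    simpa using ((hF.const_sub (F t)).sub (hG.const_sub (G t))).abs
  refine le_of_tendsto hlim ?_
  filter_upwards [eventually_le_atBot t] with a ha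
  let i₀ : Fin k := ⟨0, hk⟩
  -- The first interval is `[a, t]`, the others degenerate to `[t, t]`; letting `a → -∞` isolates
  -- the difference at `t`.
  let a' : Fin k → ℝ := fun i => if i = i₀ then a else t
  have h := sum_increments_le_kuiperDist hB (a := a') (b := fun _ => t)
    (fun i => by simp only [a']; split_ifs <;> simp [ha])
    (fun i j hij => by
      have : j ≠ i₀ := fun h => by simp [h, i₀, Fin.lt_def] at hij
      simp [a', this])
  refine le_trans ?_ h
  refine le_trans (le_of_eq ?_) (Finset.single_le_sum (fun i _ => abs_nonneg _)
    (Finset.mem_univ i₀))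
  simp [a']

theorem dist_nonneg_of_kolmogorov_or_kuiper {d : (ℝ → ℝ) → (ℝ → ℝ) → ℝ}
    (hd : d = kolmogorovDist ∨ ∃ k : ℕ, 1 ≤ k ∧ d = kuiperDist k) (F G : ℝ → ℝ) : 0 ≤ d F G := by
  obtain rfl | ⟨k, -, rfl⟩ := hd
  · exact kolmogorovDist_nonneg F G
  · exact kuiperDist_nonneg k F G

theorem exists_dist_le_add_mul {d : (ℝ → ℝ) → (ℝ → ℝ) → ℝ}
    (hd : d = kolmogorovDist ∨ ∃ k : ℕ, 1 ≤ k ∧ d = kuiperDist k) :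
    ∃ C : ℝ, ∀ (F G H : ℝ → ℝ) (B c : ℝ), (∀ t, |G t - H t| ≤ B) → (∀ t, |F t - G t| ≤ c) →
      d F H ≤ d G H + C * c := by
  obtain rfl | ⟨k, -, rfl⟩ := hd
  · exact ⟨1, fun F G H B c hB hc => by simpa using kolmogorovDist_le_add hB hc⟩
  · refine ⟨k * 2, fun F G H B c hB hc => (kuiperDist_le_add hB hc).trans (le_of_eq ?_)⟩
    ring

theorem abs_sub_le_dist {d : (ℝ → ℝ) → (ℝ → ℝ) → ℝ}
    (hd : d = kolmogorovDist ∨ ∃ k : ℕ, 1 ≤ k ∧ d = kuiperDist k) {F G : ℝ → ℝ} {B : ℝ}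
    (hB : ∀ t, |F t - G t| ≤ B) (hF : Tendsto F atBot (𝓝 0)) (hG : Tendsto G atBot (𝓝 0))
    (t : ℝ) : |F t - G t| ≤ d F G := by
  obtain rfl | ⟨k, hk, rfl⟩ := hd
  · exact abs_sub_le_kolmogorovDist hB t
  · exact abs_sub_le_kuiperDist hk hB hF hG t

/-! ### Smoothing at a positive bandwidth fixes no distribution function. -/

/-- Splitting `K` into positive and negative parts lets results on finite positive measures handle a
signed kernel. -/
theorem integral_withDensity_ofReal_sub {E : Type*} [NormedAddCommGroup E] [NormedSpace ℝ E]
    {K : ℝ → ℝ} (hK : Integrable K) {g : ℝ → E} (hg : AEStronglyMeasurable g volume) {B : ℝ}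
    (hB : ∀ u, ‖g u‖ ≤ B) :
    ∫ u, g u ∂(volume.withDensity fun u => ENNReal.ofReal (K u)) -
      ∫ u, g u ∂(volume.withDensity fun u => ENNReal.ofReal (-K u)) = ∫ u, K u • g u := by
  rw [integral_withDensity_eq_integral_toReal_smul₀ hK.aemeasurable.ennreal_ofReal (by simp),
    integral_withDensity_eq_integral_toReal_smul₀ (f := fun u => ENNReal.ofReal (-K u))
      hK.neg.aemeasurable.ennreal_ofReal (by simp),
    ← integral_sub]
  · refine integral_congr_ae (Eventually.of_forall fun u => ?_)
    simp only [ENNReal.toReal_ofReal', ← sub_smul]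
    congr 1
    obtain h | h := le_total 0 (K u)
    · simp [h]
    · simp [h]
  · simp only [ENNReal.toReal_ofReal']
    exact hK.pos_part.smul_bdd B hg (Eventually.of_forall hB)
  · simp only [ENNReal.toReal_ofReal']
    exact hK.neg_part.smul_bdd B hg (Eventually.of_forall hB)

theorem conv_real_Iic (ν μ : Measure ℝ) [IsFiniteMeasure ν] [IsProbabilityMeasure μ] (x : ℝ) :
    (ν ∗ μ).real (Iic x) = ∫ y, cdf μ (x - y) ∂ν := by
  have h1 : (ν ∗ μ).real (Iic x) = ∫ z, (Iic x).indicator (fun _ => (1 : ℝ)) z ∂(ν ∗ μ) := by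
    rw [integral_indicator measurableSet_Iic]; simp
  rw [h1, integral_conv ((integrable_const 1).indicator measurableSet_Iic)]
  refine integral_congr_ae (Eventually.of_forall fun y => ?_)
  have : ∀ z, (Iic x).indicator (fun _ => (1 : ℝ)) (y + z)
      = (Iic (x - y)).indicator (fun _ => (1 : ℝ)) z := fun z => by
    simp only [indicator, mem_Iic, le_sub_iff_add_le']
  simp only [this]
  rw [integral_indicator measurableSet_Iic, cdf_eq_real]
  simp

/-- If a distribution function is reproduced by smoothing with the kernel `K` at some bandwidth,
then the Fourier transform of `K` is one near the origin. -/
theorem eventually_fourier_eq_one {K : ℝ → ℝ} (hK : Integrable K) {μ : Measure ℝ}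
    [IsProbabilityMeasure μ] {h : ℝ} (hh : 0 < h)
    (hfix : ∀ x, cdf μ x = ∫ u, K u * cdf μ (x - h * u)) :
    ∀ᶠ w in 𝓝 (0 : ℝ), FourierTransform.fourier (fun u => (K u : ℂ)) w = 1 := by
  let κ₁ : Measure ℝ := volume.withDensity fun u => ENNReal.ofReal (K u)
  let κ₂ : Measure ℝ := volume.withDensity fun u => ENNReal.ofReal (-K u)
  have : IsFiniteMeasure κ₁ := isFiniteMeasure_withDensity_ofReal hK.2
  have : IsFiniteMeasure κ₂ := isFiniteMeasure_withDensity_ofReal hK.neg.2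
  let ν₁ := κ₁.map (fun u => h * u)
  let ν₂ := κ₂.map (fun u => h * u)
  have hmap : ∀ (κ : Measure ℝ) (x : ℝ), ∫ y, cdf μ (x - y) ∂(κ.map (fun u => h * u))
      = ∫ u, cdf μ (x - h * u) ∂κ := fun κ x =>
    integral_map (by fun_prop) (((monotone_cdf μ).measurable.comp
      (measurable_const.sub measurable_id)).aestronglyMeasurable)
  -- The fixed-point equation, with the negative part moved across so that only positive measures
  -- occur.
  have hconv : ν₁ ∗ μ = μ + ν₂ ∗ μ := by
    refine Measure.ext_of_Iic _ _ fun x => ?_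
    rw [← measureReal_eq_measureReal_iff, measureReal_add_apply, conv_real_Iic, conv_real_Iic,
      ← cdf_eq_real, hfix x, hmap, hmap, ← sub_eq_iff_eq_add]
    exact integral_withDensity_ofReal_sub hK (B := 1) (((monotone_cdf μ).measurable.comp
      (measurable_const.sub (measurable_id.const_mul h))).aestronglyMeasurable)
      fun u => by rw [Real.norm_eq_abs, abs_of_nonneg (cdf_nonneg _ _)]; exact cdf_le_one _ _
  have hchar : ∀ t, charFun κ₁ (h * t) * charFun μ t
      = charFun μ t + charFun κ₂ (h * t) * charFun μ t := fun t => by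
    have h1 : charFun (ν₁ ∗ μ) t = charFun μ t + charFun (ν₂ ∗ μ) t := by
      rw [hconv]
      have hi : ∀ ρ : Measure ℝ, IsFiniteMeasure ρ →
          Integrable (fun x : ℝ => Complex.exp (t * x * Complex.I)) ρ := fun ρ _ =>
        Integrable.of_bound (by fun_prop) 1 (Eventually.of_forall fun x => by
          rw [← Complex.ofReal_mul, Complex.norm_exp_ofReal_mul_I])
      simp only [charFun_apply_real]
      exact integral_add_measure (hi _ inferInstance) (hi _ inferInstance)
    rw [charFun_conv, charFun_conv] at h1
    simpa only [ν₁, ν₂, charFun_map_mul] using h1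
  have hsub : ∀ s, charFun κ₁ s - charFun κ₂ s
      = ∫ u, K u • Complex.exp (s * u * Complex.I) := fun s => by
    simp only [charFun_apply_real]
    exact integral_withDensity_ofReal_sub hK (B := 1) (by fun_prop) fun u => by
      rw [← Complex.ofReal_mul, Complex.norm_exp_ofReal_mul_I]
  have hne : ∀ᶠ t in 𝓝 (0 : ℝ), charFun μ t ≠ 0 :=
    continuous_charFun.continuousAt.eventually_ne (by simp)
  -- At `t = -2πw / h`, `h * t` is the frequency matching Mathlib's normalisation of the Fourier
  -- transform.
  have htend : Tendsto (fun w : ℝ => -2 * Real.pi * w / h) (𝓝 0) (𝓝 0) := by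
    have : Continuous fun w : ℝ => -2 * Real.pi * w / h := by fun_prop
    simpa using this.tendsto 0
  filter_upwards [htend.eventually hne] with w hw
  have h1 := hchar (-2 * Real.pi * w / h)
  rw [mul_div_cancel₀ _ hh.ne'] at h1
  have h2 : charFun κ₁ (-2 * Real.pi * w) - charFun κ₂ (-2 * Real.pi * w) = 1 :=
    mul_right_cancel₀ hw (by rw [sub_mul, h1]; ring)
  rw [← h2, hsub, Real.fourier_real_eq_integral_exp_smul]
  refine integral_congr_ae (Eventually.of_forall fun u => ?_)
  simp only [Complex.real_smul, smul_eq_mul]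
  rw [mul_comm]
  congr 3
  push_cast
  ring

theorem IsKernelOfOrder.integrable {K : ℝ → ℝ} {ℓ : ℕ} (hK : IsKernelOfOrder K ℓ) :
    Integrable K := by simpa using hK.integrable_moment 0 (Nat.zero_le _)

theorem IsKernelOfOrder.exists_smoothed_cdf_ne {K : ℝ → ℝ} {ℓ : ℕ} (hK : IsKernelOfOrder K ℓ)
    (μ : Measure ℝ) [IsProbabilityMeasure μ] {h : ℝ} (hh : 0 < h) :
    ∃ x, ∫ u, K u * cdf μ (x - h * u) ≠ cdf μ x := by
  by_contra! hfix
  have hF := eventually_fourier_eq_one hK.integrable hh fun x => (hfix x).symm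
  have hint : ∀ n : ℕ, (n : ℕ∞) ≤ (ℓ : ℕ∞) → Integrable fun x : ℝ => x ^ n • (K x : ℂ) := by
    intro n hn
    have := (hK.integrable_moment n (by exact_mod_cast hn)).ofReal (𝕜 := ℂ)
    refine this.congr (Eventually.of_forall fun x => ?_)
    simp
  have h1 := congrFun (Real.iteratedDeriv_fourier hint le_rfl) 0
  have hF' : FourierTransform.fourier (fun u => (K u : ℂ)) =ᶠ[𝓝 (0 : ℝ)] fun _ => 1 := hF
  -- Only derivatives of order at least one kill the constant `1`, hence the use of `1 ≤ ℓ`.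
  rw [hF'.iteratedDeriv_eq, iteratedDeriv_const, if_neg (by have := hK.one_le_order; omega),
    Real.fourier_real_eq_integral_exp_smul] at h1
  have h2 : ∫ v : ℝ, Complex.exp (↑(-2 * Real.pi * v * 0) * Complex.I) •
      ((-2 * ↑Real.pi * Complex.I * ↑v) ^ ℓ • (K v : ℂ))
      = (-2 * ↑Real.pi * Complex.I) ^ ℓ * ((∫ v : ℝ, v ^ ℓ * K v : ℝ) : ℂ) := by
    rw [← integral_complex_ofReal, ← integral_const_mul]
    refine integral_congr_ae (Eventually.of_forall fun v => ?_)
    simp only [mul_zero, Complex.ofReal_zero, zero_mul, Complex.exp_zero, smul_eq_mul,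
      Complex.ofReal_mul, Complex.ofReal_pow, mul_pow]
    ring
  rw [h2] at h1
  have h3 := hK.moment_ne_zero
  have h4 := Real.pi_ne_zero
  simp_all

/-! ### The estimator as a smoothing, and limits in the bandwidth. -/

theorem measurable_empiricalCDF (x : ℕ → ℝ) (n : ℕ) : Measurable (empiricalCDF x n) := by
  unfold empiricalCDF
  exact (Finset.measurable_sum _ fun i _ =>
    measurable_const.indicator measurableSet_Ici).const_mul _

theorem integral_Iic_scaledKernel (K : ℝ → ℝ) {h : ℝ} (hh : 0 < h) (y t : ℝ) :
    ∫ v in Iic t, scaledKernel K h (v - y)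
      = ∫ u, K u * (Ici y).indicator (fun _ => (1 : ℝ)) (t - h * u) := by
  rw [← integral_indicator measurableSet_Iic]
  have h1 : ∀ v, (Iic t).indicator (fun v => scaledKernel K h (v - y)) v
      = (fun w => h⁻¹ * (K (h⁻¹ * w) *
        (Ici y).indicator (fun _ => (1 : ℝ)) (t - h * (h⁻¹ * w)))) (v - y) := fun v => by
    simp only [indicator, mem_Iic, mem_Ici, mul_inv_cancel_left₀ hh.ne', scaledKernel]
    by_cases hv : v ≤ t
    · rw [if_pos hv, if_pos (by linarith)]; ring
    · rw [if_neg hv, if_neg (by linarith)]; ring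
  simp_rw [h1]
  rw [integral_sub_right_eq_self (fun w => h⁻¹ * (K (h⁻¹ * w) *
        (Ici y).indicator (fun _ => (1 : ℝ)) (t - h * (h⁻¹ * w)))), integral_const_mul,
    Measure.integral_comp_mul_left
      (fun u => K u * (Ici y).indicator (fun _ => (1 : ℝ)) (t - h * u)), inv_inv,
    abs_of_pos hh, smul_eq_mul, inv_mul_cancel_left₀ hh.ne']

theorem integrable_scaledKernel_sub {K : ℝ → ℝ} (hK : Integrable K) {h : ℝ} (hh : 0 < h) (y : ℝ) :
    Integrable fun v => scaledKernel K h (v - y) :=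
  ((hK.comp_mul_left' (inv_ne_zero hh.ne')).const_mul h⁻¹).comp_sub_right y

/-- Smoothing the empirical distribution function with `K` yields the kernel estimator. -/
theorem kernelCDFEstimator_eq_integral {K : ℝ → ℝ} (hK : Integrable K) {h : ℝ} (hh : 0 < h)
    (x : ℕ → ℝ) (n : ℕ) (t : ℝ) :
    kernelCDFEstimator K h x n t = ∫ u, K u * empiricalCDF x n (t - h * u) := by
  unfold kernelCDFEstimator kernelDensityEstimator empiricalCDF
  rw [integral_const_mul, integral_finsetSum _ fun i _ =>
    (integrable_scaledKernel_sub hK hh _).integrableOn]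
  simp_rw [integral_Iic_scaledKernel K hh]
  rw [← integral_finsetSum, ← integral_const_mul]
  · refine integral_congr_ae (Eventually.of_forall fun u => ?_)
    simp only [Finset.mul_sum]
    exact Finset.sum_congr rfl fun i _ => by ring
  · intro i _
    refine hK.mul_bdd (c := 1) ?_ (Eventually.of_forall fun u => ?_)
    · exact ((measurable_const.indicator measurableSet_Ici).comp
        (measurable_const.sub (measurable_id.const_mul h))).aestronglyMeasurable
    · simp only [indicator]; split_ifs <;> simp

theorem integrable_mul_comp_affine {K : ℝ → ℝ} (hK : Integrable K) {G : ℝ → ℝ}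
    (hG : Measurable G) {B : ℝ} (hB : ∀ t, |G t| ≤ B) (h t : ℝ) :
    Integrable fun u => K u * G (t - h * u) :=
  hK.mul_bdd (c := B) (hG.comp
    (measurable_const.sub (measurable_id.const_mul h))).aestronglyMeasurable
    (Eventually.of_forall fun _ => hB _)

theorem abs_integral_mul_comp_le {K : ℝ → ℝ} (hK : Integrable K) {G : ℝ → ℝ} {B : ℝ}
    (hB : ∀ t, |G t| ≤ B) (h t : ℝ) : |∫ u, K u * G (t - h * u)| ≤ B * ∫ u, |K u| := by
  rw [← integral_const_mul, ← Real.norm_eq_abs]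
  refine norm_integral_le_of_norm_le (hK.abs.const_mul B) (Eventually.of_forall fun u => ?_)
  rw [norm_mul, mul_comm]
  exact mul_le_mul_of_nonneg_right (hB _) (abs_nonneg _)

theorem tendsto_integral_mul_comp {ι : Type*} {l : Filter ι} [l.IsCountablyGenerated]
    {K : ℝ → ℝ} (hK : Integrable K) {G : ℝ → ℝ} (hG : Measurable G) {B : ℝ}
    (hB : ∀ t, |G t| ≤ B) {h t : ι → ℝ} {g : ℝ → ℝ}
    (hlim : ∀ᵐ u, Tendsto (fun i => G (t i - h i * u)) l (𝓝 (g u))) :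
    Tendsto (fun i => ∫ u, K u * G (t i - h i * u)) l (𝓝 (∫ u, K u * g u)) := by
  refine tendsto_integral_filter_of_dominated_convergence (fun u => B * |K u|)
    (Eventually.of_forall fun i => (integrable_mul_comp_affine hK hG hB _ _).1)
    (Eventually.of_forall fun i => Eventually.of_forall fun u => ?_) (hK.abs.const_mul B) ?_
  · rw [norm_mul, mul_comm]
    exact mul_le_mul_of_nonneg_right (hB _) (abs_nonneg _)
  · filter_upwards [hlim] with u hu using hu.const_mul _

theorem tendsto_empiricalCDF_atBot (x : ℕ → ℝ) (n : ℕ) :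
    Tendsto (empiricalCDF x n) atBot (𝓝 0) := by
  unfold empiricalCDF
  have : Tendsto (fun t => ∑ i ∈ Finset.range n, (Ici (x i)).indicator (fun _ => (1 : ℝ)) t)
      atBot (𝓝 (∑ i ∈ Finset.range n, 0)) := by
    refine tendsto_finsetSum _ fun i _ => tendsto_const_nhds.congr' ?_
    filter_upwards [eventually_lt_atBot (x i)] with t ht
    simp [ht]
  simpa using this.const_mul (n : ℝ)⁻¹

theorem tendsto_kernelCDFEstimator_atBot (K : ℝ → ℝ) (h : ℝ) (x : ℕ → ℝ) (n : ℕ) {B : ℝ}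
    (hK : Integrable K) (hh : 0 < h) (hB : ∀ t, |empiricalCDF x n t| ≤ B) :
    Tendsto (kernelCDFEstimator K h x n) atBot (𝓝 0) := by
  have := tendsto_integral_mul_comp hK (measurable_empiricalCDF x n) hB (l := atBot)
    (h := fun _ => h) (t := id) (g := fun _ => 0) (Eventually.of_forall fun u =>
      (tendsto_empiricalCDF_atBot x n).comp (tendsto_atBot_add_const_right _ (-(h * u)) tendsto_id))
  simp only [mul_zero, integral_zero] at this
  exact this.congr fun t => (kernelCDFEstimator_eq_integral hK hh x n t).symm

theorem abs_cdf_le_one (μ : Measure ℝ) [IsProbabilityMeasure μ] (t : ℝ) : |cdf μ t| ≤ 1 := by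
  rw [abs_of_nonneg (cdf_nonneg μ t)]; exact cdf_le_one μ t

theorem tendsto_smoothed_cdf_atTop {K : ℝ → ℝ} (hK : Integrable K) (μ : Measure ℝ)
    [IsProbabilityMeasure μ] (x : ℝ) :
    Tendsto (fun h => ∫ u, K u * cdf μ (x - h * u)) atTop
      (𝓝 (∫ u, K u * (Iio (0 : ℝ)).indicator (fun _ => (1 : ℝ)) u)) := by
  refine tendsto_integral_mul_comp hK (monotone_cdf μ).measurable (abs_cdf_le_one μ)
    (h := id) (t := fun _ => x) ?_
  -- At `u = 0` the integrand stays at `cdf μ x`, so this null set is discarded.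
  filter_upwards [compl_mem_ae_iff.2 (Real.volume_singleton (a := 0))] with u hu
  obtain hu | hu := lt_or_gt_of_ne hu
  · rw [indicator_of_mem (by exact hu)]
    refine (tendsto_cdf_atTop μ).comp ?_
    simp only [sub_eq_add_neg, ← mul_neg]
    exact tendsto_atTop_add_const_left _ _ (tendsto_id.atTop_mul_const (neg_pos.2 hu))
  · rw [indicator_of_notMem (by simpa using hu.le)]
    refine (tendsto_cdf_atBot μ).comp ?_
    simp only [sub_eq_add_neg, ← mul_neg]
    exact tendsto_atBot_add_const_left _ _
      (tendsto_id.atTop_mul_const_of_neg (neg_neg_iff_pos.2 hu))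

theorem tendsto_smoothed_cdf_nhds {K : ℝ → ℝ} (hK : Integrable K) {μ : Measure ℝ}
    [IsProbabilityMeasure μ] (hμ : Continuous (fun t : ℝ => cdf μ t)) (x h₀ : ℝ) :
    Tendsto (fun h => ∫ u, K u * cdf μ (x - h * u)) (𝓝 h₀)
      (𝓝 (∫ u, K u * cdf μ (x - h₀ * u))) := by
  refine tendsto_integral_mul_comp hK (monotone_cdf μ).measurable (abs_cdf_le_one μ)
    (h := id) (t := fun _ => x) (Eventually.of_forall fun u => ?_)
  have : Continuous fun h : ℝ => cdf μ (x - h * u) := hμ.comp (by fun_prop)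
  exact this.tendsto h₀

/-- Bandwidths along which the smoothed distribution function converges to the original one
tend to zero. -/
theorem tendsto_bandwidth_zero {K : ℝ → ℝ} {ℓ : ℕ} (hK : IsKernelOfOrder K ℓ) {μ : Measure ℝ}
    [IsProbabilityMeasure μ] (hμ : Continuous (fun t : ℝ => cdf μ t)) {h : ℕ → ℝ}
    (hpos : ∀ᶠ n in atTop, 0 < h n)
    (hlim : ∀ x, Tendsto (fun n => ∫ u, K u * cdf μ (x - h n * u)) atTop (𝓝 (cdf μ x))) :
    Tendsto h atTop (𝓝 0) := by
  rw [tendsto_iff_ultrafilter]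
  intro U hU
  obtain ⟨L, hL⟩ : ∃ L : EReal, Tendsto (fun n => (h n : EReal)) U (𝓝 L) :=
    ⟨_, (U.map (fun n => (h n : EReal))).le_nhds_lim⟩
  have hL0 : 0 ≤ L := ge_of_tendsto hL (by
    filter_upwards [hU hpos] with n hn using EReal.coe_nonneg.2 (le_of_lt hn))
  induction L with
  | bot => simp at hL0
  | top =>
    have htop : Tendsto h U atTop := EReal.tendsto_coe_nhds_top_iff.1 hL
    have hconst : ∀ x, cdf μ x = ∫ u, K u * (Iio (0 : ℝ)).indicator (fun _ => (1 : ℝ)) u :=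
      fun x => tendsto_nhds_unique ((hlim x).mono_left hU)
        ((tendsto_smoothed_cdf_atTop hK.integrable μ x).comp htop)
    have h0 := tendsto_cdf_atBot μ
    have h1 := tendsto_cdf_atTop μ
    -- The limit does not depend on `x`, so it would equal both `0` and `1`.
    rw [funext hconst] at h0 h1
    have := tendsto_nhds_unique h0 tendsto_const_nhds
    have := tendsto_nhds_unique h1 tendsto_const_nhds
    linarith
  | coe h₀ =>
    have hh : Tendsto h U (𝓝 h₀) := EReal.tendsto_coe.1 hL
    obtain rfl | hne := eq_or_ne h₀ 0
    · exact hh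
    · obtain ⟨x, hx⟩ := hK.exists_smoothed_cdf_ne μ
        (lt_of_le_of_ne (EReal.coe_nonneg.1 hL0) hne.symm)
      exact absurd (tendsto_nhds_unique
        ((tendsto_smoothed_cdf_nhds hK.integrable hμ x h₀).comp hh) ((hlim x).mono_left hU)) hx

/-! ### The main theorem. -/

theorem mainTheorem5 {Ω : Type*} [MeasurableSpace Ω] (P : Measure Ω) [IsProbabilityMeasure P]
    (μ : Measure ℝ) [IsProbabilityMeasure μ] (hμ : Continuous (fun t : ℝ => cdf μ t))
    (X : ℕ → Ω → ℝ) (hX_law : ∀ i, HasLaw (X i) μ P) (hX_indep : iIndepFun X P)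
    (K : ℝ → ℝ) (ℓ : ℕ) (hK : IsKernelOfOrder K ℓ)
    (d : (ℝ → ℝ) → (ℝ → ℝ) → ℝ)
    (hd : d = kolmogorovDist ∨ ∃ k : ℕ, 1 ≤ k ∧ d = kuiperDist k)
    (s : ℕ → ℝ) (hs : Tendsto s atTop (𝓝 0)) :
    ∀ᵐ ω ∂P, ∀ h : ℕ → ℝ,
      (∀ᶠ n in atTop, 0 < h n ∧
        d (empiricalCDF (fun i => X i ω) n)
          (kernelCDFEstimator K (h n) (fun i => X i ω) n) = s n) →
      Tendsto (fun n => d (fun t => cdf μ t)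
          (kernelCDFEstimator K (h n) (fun i => X i ω) n)) atTop (𝓝 0) ∧
        Tendsto h atTop (𝓝 0) := by
  filter_upwards [ae_tendstoUniformly_empiricalCDF hμ hX_law hX_indep] with ω hω h hh
  generalize (fun i => X i ω) = x at hω hh ⊢
  have hKi := hK.integrable
  have hFn : ∀ n t, |empiricalCDF x n t| ≤ 1 := fun n t => by
    rw [abs_of_nonneg (empiricalCDF_nonneg x n t)]; exact empiricalCDF_le_one x n t
  have hFhat : ∀ n, 0 < h n → ∀ t, |kernelCDFEstimator K (h n) x n t| ≤ 1 * ∫ u, |K u| :=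
    fun n hn t => by
      rw [kernelCDFEstimator_eq_integral hKi hn]
      exact abs_integral_mul_comp_le hKi (hFn n) _ _
  have hA : 0 ≤ ∫ u, |K u| := integral_nonneg fun u => abs_nonneg _
  have hunif : ∀ c > 0, ∀ᶠ n in atTop, ∀ t, |cdf μ t - empiricalCDF x n t| ≤ c := fun c hc =>
    (Metric.tendstoUniformly_iff.1 hω c hc).mono fun n hn t => (hn t).le
  obtain ⟨C, hC⟩ := exists_dist_le_add_mul hd
  have hdist : Tendsto (fun n => d (fun t => cdf μ t) (kernelCDFEstimator K (h n) x n))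
      atTop (𝓝 0) := by
    rw [Metric.tendsto_nhds]
    intro ε hε
    -- Chosen so that `C` times the uniform error is at most `ε / 2`; the `+ 1` keeps the
    -- denominator positive.
    have hc : 0 < ε / (2 * (|C| + 1)) := by positivity
    filter_upwards [hh, hunif _ hc, hs.eventually (gt_mem_nhds (half_pos hε))] with n hn hcn hsn
    have h1 := hC (fun t => cdf μ t) (empiricalCDF x n) (kernelCDFEstimator K (h n) x n) _ _
      (fun t => (abs_sub _ _).trans (add_le_add (hFn n t) (hFhat n hn.1 t))) hcn
    rw [hn.2] at h1
    have h2 : C * (ε / (2 * (|C| + 1))) ≤ ε / 2 := by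
      have : (|C| + 1) * (ε / (2 * (|C| + 1))) = ε / 2 := by field_simp
      rw [← this]
      exact mul_le_mul_of_nonneg_right (by linarith [le_abs_self C]) hc.le
    rw [Real.dist_eq, sub_zero, abs_of_nonneg (dist_nonneg_of_kolmogorov_or_kuiper hd _ _)]
    linarith
  refine ⟨hdist, tendsto_bandwidth_zero hK hμ (hh.mono fun n hn => hn.1) fun t => ?_⟩
  have hest : Tendsto (fun n => cdf μ t - kernelCDFEstimator K (h n) x n t) atTop (𝓝 0) := by
    refine squeeze_zero_norm' ?_ hdist
    filter_upwards [hh] with n hn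
    exact abs_sub_le_dist hd
      (fun t => (abs_sub _ _).trans (add_le_add (abs_cdf_le_one μ t) (hFhat n hn.1 t)))
      (tendsto_cdf_atBot μ) (tendsto_kernelCDFEstimator_atBot K (h n) x n hKi hn.1 (hFn n)) t
  -- The error of replacing `F_n` by `F` under the smoothing is at most `∫ |K|` times their uniform
  -- distance, whatever the bandwidth.
  have hsmooth : Tendsto (fun n => (∫ u, K u * cdf μ (t - h n * u)) -
      kernelCDFEstimator K (h n) x n t) atTop (𝓝 0) := by
    rw [Metric.tendsto_nhds]
    intro ε hε
    have hc : 0 < ε / ((∫ u, |K u|) + 1) := by positivity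
    filter_upwards [hh, hunif _ hc] with n hn hcn
    rw [Real.dist_eq, sub_zero, kernelCDFEstimator_eq_integral hKi hn.1, ← integral_sub
      (integrable_mul_comp_affine hKi (monotone_cdf μ).measurable (abs_cdf_le_one μ) _ _)
      (integrable_mul_comp_affine hKi (measurable_empiricalCDF x n) (hFn n) _ _)]
    simp_rw [← mul_sub]
    refine (abs_integral_mul_comp_le hKi (G := fun t => cdf μ t - empiricalCDF x n t)
      hcn (h n) t).trans_lt ?_
    rw [div_mul_eq_mul_div, div_lt_iff₀ (by positivity)]
    exact mul_lt_mul_of_pos_left (by linarith) hε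
  have := (hsmooth.sub hest).add_const (cdf μ t)
  simp only [sub_zero, zero_add] at this
  exact this.congr fun n => by ring
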